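/- Let $\mathcal C\subseteq\mathbb F_2^N$ be a binary linear code of dimension $K$ and rate $K/N$. Call $\mathcal C$ \emph{2-transitive} if for all positions $a\ne b$ and $c\ne d$ in $\{1,\dots,N\}$ there is a permutation $\pi$ of $\{1,\dots,N\}$ with $\pi(a)=c$, $\pi(b)=d$ such that $(x_1,\dots,x_N)\in\mathcal C$ if and only if $(x_{\pi(1)},\dots,x_{\pi(N)})\in\mathcal C$. Let a uniformly distributed codeword $X\in\mathcal C$ be transmitted over the binary erasure channel BEC$(\epsilon)$, which erases each bit independently with probability $\epsilon$, with output $Y$. The bit-MAP decoder of the $i$th bit outputs the value $b$ that maximizes $\mathbb P(X_i=b\mid Y)$, and declares failure in case of a tie; the bit error probability at position $i$ is the probability that its output is not $X_i$ (failure counting as an error). (1) Let $(\mathcal C_k)$ be a sequence of 2-transitive binary linear codes whose block lengths $N_k$ tend to infinity and whose rates converge to some $R$ with $0<R<1$. Then $(\mathcal C_k)$ achieves capacity on the BEC under bit-MAP decoding: for every $0\le\epsilon<1-R$ and every $\delta>0$ there is a $k_0$ such that for all $k>k_0$ the bit error probability of $\mathcal C_k$ on BEC$(\epsilon)$ is at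 most $\delta$ at every position $i$. (2) Extended BCH codes are an example. For $m\ge1$, a primitive element $\alpha$ of $\mathbb F_{2^m}$ and an integer $d\ge0$, let the extended BCH code be the (primitive, narrow-sense) binary BCH code $\{c\in\mathbb F_2^{2^m-1}: \sum_i c_i\alpha^{ij}=0 \text{ for } 1\le j\le d-1\}$, where $i$ runs from $0$ to $2^m-2$, extended by an overall parity check bit. Every such code, of length $2^m$, is 2-transitive. Consequently every sequence of extended BCH codes with $m\to\infty$ and rates converging to some $R$ with $0<R<1$ (where $\alpha$ and $d$ may vary along the sequence) achieves capacity on the BEC under bit-MAP decoding in the sense of (1). -/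

import Mathlib

open Filter Topology

noncomputable section

/-- A binary linear code of block length `N`. -/
abbrev BinaryLinearCode (N : ℕ) := Submodule (ZMod 2) (Fin N → ZMod 2)

namespace BinaryLinearCode

/-- The rate `K / N`, where `K` is the dimension of the code. -/
def rate {N : ℕ} (C : BinaryLinearCode N) : ℝ :=
  (Module.finrank (ZMod 2) C : ℝ) / (N : ℝ)

/-- The code is invariant under permutations of the coordinates that act 2-transitively: every
ordered pair of distinct positions is carried to every other one by a permutation `π` such that
`(x_1, …, x_N) ∈ C` if and only if `(x_{π(1)}, …, x_{π(N)}) ∈ C`. (The permutations with the latter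
property always form a group.) -/
def IsTwoTransitive {N : ℕ} (C : BinaryLinearCode N) : Prop :=
  ∀ a b c d : Fin N, a ≠ b → c ≠ d →
    ∃ π : Equiv.Perm (Fin N), π a = c ∧ π b = d ∧
      ∀ x : Fin N → ZMod 2, x ∈ C ↔ (fun i => x (π i)) ∈ C

/-- Transition probabilities of the binary erasure channel with erasure probability `ε`: `none`
is the erasure symbol, `some b` is the bit `b` received correctly. -/
def becTransition (ε : ℝ) (x : ZMod 2) : Option (ZMod 2) → ℝ
  | none => ε
  | some z => if z = x then 1 - ε else 0

open Classical in
/-- The joint probability `P(X = x, Y = y)`, where `X` is uniform on the code `C` and `Y` is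
the output of `N` independent uses of the erasure channel on the bits of `X`. -/
def jointProb {N : ℕ} (C : BinaryLinearCode N) (ε : ℝ)
    (x : Fin N → ZMod 2) (y : Fin N → Option (ZMod 2)) : ℝ :=
  if x ∈ C then (1 / (Nat.card C : ℝ)) * ∏ i, becTransition ε (x i) (y i) else 0

/-- `P(Y = y)`. -/
def outputProb {N : ℕ} (C : BinaryLinearCode N) (ε : ℝ) (y : Fin N → Option (ZMod 2)) : ℝ :=
  ∑ x : Fin N → ZMod 2, jointProb C ε x y

/-- The posterior probability `P(X_i = b | Y = y)`. -/
def bitPosterior {N : ℕ} (C : BinaryLinearCode N) (ε : ℝ) (i : Fin N) (b : ZMod 2)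
    (y : Fin N → Option (ZMod 2)) : ℝ :=
  (∑ x : Fin N → ZMod 2, if x i = b then jointProb C ε x y else 0) / outputProb C ε y

open Classical in
/-- The bit-MAP decoder of the `i`-th code bit from the whole channel output: the value with the
larger posterior probability; in case of a tie it declares failure (`none`). -/
def bitMAP {N : ℕ} (C : BinaryLinearCode N) (ε : ℝ) (i : Fin N)
    (y : Fin N → Option (ZMod 2)) : Option (ZMod 2) :=
  if bitPosterior C ε i 1 y < bitPosterior C ε i 0 y then some 0
  else if bitPosterior C ε i 0 y < bitPosterior C ε i 1 y then some 1
  else none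

/-- The error probability of the bit-MAP decoder at position `i`; a declared failure counts as an
error, so that this bounds the error probability of MAP decoding under every tie-breaking rule. -/
def bitErrorProb {N : ℕ} (C : BinaryLinearCode N) (ε : ℝ) (i : Fin N) : ℝ :=
  ∑ x : Fin N → ZMod 2, ∑ y : Fin N → Option (ZMod 2),
    if bitMAP C ε i y = some (x i) then 0 else jointProb C ε x y

/-- The bit error probability under bit-MAP decoding vanishes, uniformly in the position of the
bit, on every erasure channel whose capacity `1 - ε` exceeds `R`. -/
def BitErrorVanishesBelowCapacity {N : ℕ → ℕ} (C : ∀ k, BinaryLinearCode (N k)) (R : ℝ) : Prop :=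
  ∀ ε : ℝ, 0 ≤ ε → ε < 1 - R → ∀ δ : ℝ, 0 < δ →
    ∃ k₀ : ℕ, ∀ k : ℕ, k₀ < k → ∀ i : Fin (N k), bitErrorProb (C k) ε i ≤ δ

/-- The code extended by an overall parity check bit in the last position. -/
def extend {n : ℕ} (C : BinaryLinearCode n) : BinaryLinearCode (n + 1) where
  carrier := {c | (fun i : Fin n => c i.castSucc) ∈ C ∧ ∑ i, c i = 0}
  zero_mem' := ⟨C.zero_mem, by simp⟩
  add_mem' := by
    rintro a b ⟨ha, ha'⟩ ⟨hb, hb'⟩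
    exact ⟨C.add_mem ha hb, by simp [Finset.sum_add_distrib, ha', hb']⟩
  smul_mem' := by
    rintro r a ⟨ha, ha'⟩
    exact ⟨C.smul_mem r ha, by simp [← Finset.mul_sum, ha']⟩

/-- The binary primitive narrow-sense BCH code of length `2 ^ m - 1` and designed distance `d`
with respect to `α` (a primitive element of the field with `2 ^ m` elements): the words whose
polynomial `c_0 + c_1 z + c_2 z ^ 2 + ⋯` vanishes at `α, α ^ 2, …, α ^ (d - 1)`. -/
def bch (m : ℕ) (α : GaloisField 2 m) (d : ℕ) : BinaryLinearCode (2 ^ m - 1) where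
  carrier := {c | ∀ j : ℕ, 1 ≤ j → j < d →
    ∑ i, algebraMap (ZMod 2) (GaloisField 2 m) (c i) * (α ^ j) ^ (i : ℕ) = 0}
  zero_mem' := by
    intro j _ _
    simp
  add_mem' := by
    intro a b ha hb j h1 h2
    simp [add_mul, Finset.sum_add_distrib, ha j h1 h2, hb j h1 h2]
  smul_mem' := by
    intro r a ha j h1 h2
    simp [mul_assoc, ← Finset.mul_sum, ha j h1 h2]

/-- The extended BCH code, of length `2 ^ m` (for `m ≥ 1`). -/
def extendedBCH (m : ℕ) (α : GaloisField 2 m) (d : ℕ) : BinaryLinearCode (2 ^ m - 1 + 1) :=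
  extend (bch m α d)

end BinaryLinearCode

end

/-! Let each bit be received with probability `p = 1 - ε`. By linearity, bit `i` fails to be
determined by the other received bits exactly when some codeword vanishes on them but not at `i`.
The probability of this event is the EXIT function `exit i p`; it bounds the bit error probability
(`bitErrorProb_le_exit`) and decreases in `p`.

Area theorem: the expected dimension of the subcode vanishing on the received positions falls from
`K` at `p = 0` to `0` at `p = 1`. By the Margulis–Russo formula its derivative is minus the sum of
the EXIT functions, which are all equal by transitivity. Hence an EXIT function at least `a` on `[0,
p]` forces `a * p ≤ K / N` (`mul_le_rate`).

Sharp threshold: a Talagrand-type inequality (`variance_mul_log_le`), derived from a logarithmic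
Sobolev inequality applied to martingale increments, compares the variance of the EXIT event with
its influences. By 2-transitivity the influences of all `j ≠ i` agree, so none dominates, and the
slope grows with `log (N - 1)` wherever the EXIT function stays away from `0` and `1`
(`le_exit_of_lt_exit`). If the error stayed above `δ` at some `1 - ε > R`, the EXIT function would
be almost `1` at a point `p₁ > R`, and the area theorem would push the rate above `R`.

Extended BCH codes, indexed by the points of the field, are cut out by vanishing power sums of
bounded degree. Affine substitutions preserve such conditions, and the affine group is 2-transitive.
-/

noncomputable section

/-! ### The biased cube: averaging operators and the Margulis–Russo formula -/

namespace BiasedCube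

open Function Finset

variable {ι : Type*}

/-- The product weight on the cube under which each coordinate is `true` with probability `p`. -/
def weight [Fintype ι] (p : ℝ) (x : ι → Bool) : ℝ := ∏ i, if x i = true then p else 1 - p

theorem weight_nonneg [Fintype ι] {p : ℝ} (h0 : 0 ≤ p) (h1 : p ≤ 1) (x : ι → Bool) :
    0 ≤ weight p x :=
  prod_nonneg fun i _ => by split_ifs <;> linarith

variable [DecidableEq ι]

/-- The average over the `i`-th coordinate. -/
def avg (p : ℝ) (i : ι) (f : (ι → Bool) → ℝ) (x : ι → Bool) : ℝ :=
  p * f (update x i true) + (1 - p) * f (update x i false)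

/-- The discrete derivative in the `i`-th coordinate. -/
def diff (i : ι) (f : (ι → Bool) → ℝ) (x : ι → Bool) : ℝ :=
  f (update x i true) - f (update x i false)

/-- The average over all coordinates in a list. -/
def avgList (p : ℝ) (l : List ι) (f : (ι → Bool) → ℝ) : (ι → Bool) → ℝ :=
  l.foldr (avg p) f

theorem avg_mono {p : ℝ} (h0 : 0 ≤ p) (h1 : p ≤ 1) (i : ι) {f g : (ι → Bool) → ℝ}
    (h : ∀ x, f x ≤ g x) (x : ι → Bool) : avg p i f x ≤ avg p i g x :=
  add_le_add (mul_le_mul_of_nonneg_left (h _) h0)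
    (mul_le_mul_of_nonneg_left (h _) (sub_nonneg.2 h1))

theorem diff_avg_self (p : ℝ) (i : ι) (f : (ι → Bool) → ℝ) : diff i (avg p i f) = fun _ => 0 := by
  ext x; simp [diff, avg]

theorem avg_diff_self (p : ℝ) (i : ι) (f : (ι → Bool) → ℝ) : avg p i (diff i f) = diff i f := by
  ext x; simp [diff, avg]; ring

theorem diff_avg_of_ne (p : ℝ) {i k : ι} (h : i ≠ k) (f : (ι → Bool) → ℝ) :
    diff i (avg p k f) = avg p k (diff i f) := by
  ext x; simp [diff, avg, update_comm h]; ring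

theorem update_eq_of_diff_eq_zero {i : ι} {f : (ι → Bool) → ℝ} (h : diff i f = fun _ => 0)
    (x : ι → Bool) (b : Bool) : f (update x i b) = f x := by
  have h1 : f (update x i true) = f (update x i false) := sub_eq_zero.1 (congrFun h x)
  have h2 : f x = f (update x i (x i)) := by simp
  rw [h2]
  rcases b <;> rcases x i <;> simp [h1]

theorem diff_avgList_of_notMem (p : ℝ) {i : ι} {l : List ι} (h : i ∉ l) (f : (ι → Bool) → ℝ) :
    diff i (avgList p l f) = avgList p l (diff i f) := by
  induction l with
  | nil => rfl
  | cons k l ih =>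
    rw [List.mem_cons, not_or] at h
    change diff i (avg p k (avgList p l f)) = avg p k (avgList p l (diff i f))
    rw [diff_avg_of_ne p h.1, ih h.2]

theorem diff_avgList_of_mem (p : ℝ) {i : ι} {l : List ι} (h : i ∈ l) (f : (ι → Bool) → ℝ) :
    diff i (avgList p l f) = fun _ => 0 := by
  induction l with
  | nil => simp at h
  | cons k l ih =>
    change diff i (avg p k (avgList p l f)) = _
    by_cases hik : i = k
    · subst hik; exact diff_avg_self p i _
    · rw [diff_avg_of_ne p hik, ih ((List.mem_cons.1 h).resolve_left hik)]
      ext x; simp [avg]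

/-- The Margulis–Russo formula one coordinate at a time. By the product rule, differentiating the
weight of the head `k` produces `diff k`, and differentiating the inner averages produces the terms
of the tail. -/
theorem hasDerivAt_avgList (p : ℝ) {l : List ι} (hl : l.Nodup) (f : (ι → Bool) → ℝ)
    (x : ι → Bool) :
    HasDerivAt (fun t => avgList t l f x) (l.map fun j => avgList p l (diff j f) x).sum p := by
  induction l generalizing x with
  | nil => simpa [avgList] using hasDerivAt_const p (f x)
  | cons k l ih =>
    rw [List.nodup_cons] at hl
    have h1 := (hasDerivAt_id p).mul (ih hl.2 (update x k true))
    have h0 := ((hasDerivAt_id p).const_sub 1).mul (ih hl.2 (update x k false))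
    refine (h1.add h0).congr_deriv ?_
    have hk : avgList p (k :: l) (diff k f) x = diff k (avgList p l f) x := by
      change avg p k (avgList p l (diff k f)) x = _
      rw [← diff_avgList_of_notMem p hl.1, avg_diff_self]
    have hs : ∀ l' : List ι, (l'.map fun j => avgList p (k :: l) (diff j f) x).sum =
        p * (l'.map fun j => avgList p l (diff j f) (update x k true)).sum +
        (1 - p) * (l'.map fun j => avgList p l (diff j f) (update x k false)).sum := by
      intro l'
      induction l' with
      | nil => simp
      | cons a l' ih' =>
        rw [List.map_cons, List.sum_cons, ih']
        simp only [List.map_cons, List.sum_cons]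
        change avg p k (avgList p l (diff a f)) x + _ = _
        unfold avg
        ring
    rw [List.map_cons, List.sum_cons, hs, hk]
    simp [diff]
    ring

variable [Fintype ι]

/-- The expectation under the `p`-biased product measure. -/
def mean (p : ℝ) (f : (ι → Bool) → ℝ) : ℝ := ∑ x, weight p x * f x

theorem sum_weight (p : ℝ) : ∑ x : ι → Bool, weight p x = 1 := by
  have h := Finset.prod_univ_sum (fun _ : ι => (univ : Finset Bool))
    (fun _ b => if b = true then p else 1 - p)
  rw [Fintype.piFinset_univ] at h
  unfold weight
  rw [← h]
  simp

theorem mean_const (p c : ℝ) : mean p (fun _ : ι → Bool => c) = c := by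
  simp [mean, ← sum_mul, sum_weight]

theorem mean_add (p : ℝ) (f g : (ι → Bool) → ℝ) :
    mean p (fun x => f x + g x) = mean p f + mean p g := by
  simp [mean, mul_add, sum_add_distrib]

theorem mean_sub (p : ℝ) (f g : (ι → Bool) → ℝ) :
    mean p (fun x => f x - g x) = mean p f - mean p g := by
  simp [mean, mul_sub, sum_sub_distrib]

theorem mean_const_mul (p c : ℝ) (f : (ι → Bool) → ℝ) :
    mean p (fun x => c * f x) = c * mean p f := by
  simp only [mean, mul_sum]
  exact sum_congr rfl fun x _ => by ring

theorem mean_mono {p : ℝ} (h0 : 0 ≤ p) (h1 : p ≤ 1) {f g : (ι → Bool) → ℝ}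
    (h : ∀ x, f x ≤ g x) : mean p f ≤ mean p g :=
  sum_le_sum fun x _ => mul_le_mul_of_nonneg_left (h x) (weight_nonneg h0 h1 x)

theorem mean_nonneg {p : ℝ} (h0 : 0 ≤ p) (h1 : p ≤ 1) {f : (ι → Bool) → ℝ}
    (h : ∀ x, 0 ≤ f x) : 0 ≤ mean p f :=
  sum_nonneg fun x _ => mul_nonneg (weight_nonneg h0 h1 x) (h x)

theorem mean_comp_perm (p : ℝ) (π : Equiv.Perm ι) (f : (ι → Bool) → ℝ) :
    mean p (fun x => f (x ∘ π)) = mean p f := by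
  refine Fintype.sum_equiv (Equiv.arrowCongr π.symm (Equiv.refl Bool)) _ _ fun x => ?_
  have hx : (Equiv.arrowCongr π.symm (Equiv.refl Bool)) x = x ∘ π := by
    ext i; simp
  rw [hx]
  congr 1
  exact (Equiv.prod_comp π fun i => if x i = true then p else 1 - p).symm

theorem mean_avg (p : ℝ) (i : ι) (f : (ι → Bool) → ℝ) : mean p (avg p i f) = mean p f := by
  -- Pairing each point with its flip at `i` reduces the identity to a two-point computation; the
  -- factor 2 counts each pair twice.
  have hinv : Involutive fun x : ι → Bool => update x i (!x i) := fun x => by simp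
  have hsum : ∀ g : (ι → Bool) → ℝ, 2 * ∑ x, g x = ∑ x, (g x + g (update x i (!x i))) := fun g => by
    rw [sum_add_distrib, (hinv.bijective.sum_comp g), two_mul]
  have hw : ∀ (x : ι → Bool) (b : Bool), weight p (update x i b) =
      (if b = true then p else 1 - p) * ∏ j ∈ univ.erase i, if x j = true then p else 1 - p := by
    intro x b
    rw [weight, ← mul_prod_erase univ _ (mem_univ i)]
    congr 1
    · simp
    · exact prod_congr rfl fun j hj => by rw [update_of_ne (ne_of_mem_erase hj)]
  have hw' : ∀ x : ι → Bool, weight p x =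
      (if x i = true then p else 1 - p) * ∏ j ∈ univ.erase i, if x j = true then p else 1 - p := by
    intro x
    simpa using hw x (x i)
  have h2 : 2 * mean p (avg p i f) = 2 * mean p f := by
    unfold mean
    rw [hsum, hsum]
    refine sum_congr rfl fun x _ => ?_
    rw [hw, hw' x]
    rcases hx : x i
    · have hxe : update x i false = x := by rw [← hx]; simp
      simp [avg, hxe]
      ring
    · have hxe : update x i true = x := by rw [← hx]; simp
      simp [avg, hxe]
      ring
  linarith

theorem mean_avgList (p : ℝ) (l : List ι) (f : (ι → Bool) → ℝ) :
    mean p (avgList p l f) = mean p f := by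
  induction l with
  | nil => rfl
  | cons k l ih => exact (mean_avg p k _).trans ih

theorem eq_of_diff_eq_zero {f : (ι → Bool) → ℝ} (h : ∀ i, diff i f = fun _ => 0)
    (x y : ι → Bool) : f x = f y := by
  have key : ∀ s : Finset ι, f (fun i => if i ∈ s then y i else x i) = f x := by
    intro s
    induction s using Finset.induction_on with
    | empty => simp
    | insert a s ha ih =>
      rw [← ih, ← update_eq_of_diff_eq_zero (h a) (fun i => if i ∈ s then y i else x i) (y a)]
      congr 1
      ext i
      by_cases hi : i = a
      · subst hi; simp
      · simp [hi]
  simpa using (key univ).symm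

/-- Once every coordinate is averaged out all derivatives vanish, so the result is a constant, and
averaging has not changed the mean. -/
theorem avgList_univ (p : ℝ) (f : (ι → Bool) → ℝ) (x : ι → Bool) :
    avgList p (univ : Finset ι).toList f x = mean p f := by
  have h : avgList p (univ : Finset ι).toList f = fun _ => avgList p (univ : Finset ι).toList f x :=
    funext fun y => eq_of_diff_eq_zero (fun i => diff_avgList_of_mem p (by simp) f) y x
  rw [← mean_avgList p (univ : Finset ι).toList f, h, mean_const]

/-- The Margulis–Russo formula. -/
theorem hasDerivAt_mean (p : ℝ) (f : (ι → Bool) → ℝ) :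
    HasDerivAt (fun t => mean t f) (∑ j, mean p (diff j f)) p := by
  have h := hasDerivAt_avgList p (nodup_toList (univ : Finset ι)) f (fun _ => true)
  simp only [avgList_univ] at h
  simpa using h

/-- Pythagoras: `avg p k` is an orthogonal projection for the `p`-biased inner product. -/
theorem mean_sq_sub_mean_avg_sq (p : ℝ) (k : ι) (g : (ι → Bool) → ℝ) :
    mean p (fun x => (g x - avg p k g x) ^ 2) =
      mean p (fun x => g x ^ 2) - mean p (fun x => avg p k g x ^ 2) := by
  have h : mean p (fun x => g x * avg p k g x) = mean p (fun x => avg p k g x ^ 2) := by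
    rw [← mean_avg p k]
    congr 1
    ext x
    simp [avg]
    ring
  have h2 : (fun x => (g x - avg p k g x) ^ 2) =
      fun x => (g x ^ 2 + avg p k g x ^ 2) - 2 * (g x * avg p k g x) := by
    ext x; ring
  rw [h2, mean_sub, mean_add, mean_const_mul, h]
  ring

end BiasedCube

/-! ### Logarithmic Sobolev and Talagrand-type inequalities, uniform in `p` -/

namespace BiasedCube

open Function Finset

variable {ι : Type*}

theorem mul_log_le_of_pos {a m : ℝ} (ha : 0 ≤ a) (hm : 0 < m) :
    a * Real.log a - a * Real.log m ≤ a * (a / m - 1) := by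
  rcases ha.eq_or_lt with rfl | ha
  · simp
  · rw [← mul_sub, ← Real.log_div ha.ne' hm.ne']
    exact mul_le_mul_of_nonneg_left (Real.log_le_sub_one_of_pos (by positivity)) ha.le

/-- A logarithmic Sobolev inequality on a biased two-point space. -/
theorem two_point_log_sobolev {p a b : ℝ} (h0 : 0 ≤ p) (h1 : p ≤ 1) (ha : 0 ≤ a) (hb : 0 ≤ b) :
    p * (a * Real.log a) + (1 - p) * (b * Real.log b) -
      (p * a + (1 - p) * b) * Real.log (p * a + (1 - p) * b) ≤ 2 * (√a - √b) ^ 2 := by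
  have hq : 0 ≤ 1 - p := sub_nonneg.2 h1
  have hpa : 0 ≤ p * a := mul_nonneg h0 ha
  have hqb : 0 ≤ (1 - p) * b := mul_nonneg hq hb
  rcases (add_nonneg hpa hqb).eq_or_lt with hm | hm
  · have e1 : p * a = 0 := by linarith
    have e2 : (1 - p) * b = 0 := by linarith
    rw [← mul_assoc, ← mul_assoc, e1, e2]
    simp only [zero_mul, add_zero, sub_zero]
    positivity
  · obtain ⟨m, hmd⟩ : ∃ m, m = p * a + (1 - p) * b := ⟨_, rfl⟩
    rw [← hmd] at hm ⊢
    have k1 := mul_le_mul_of_nonneg_left (mul_log_le_of_pos ha hm) h0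
    have k2 := mul_le_mul_of_nonneg_left (mul_log_le_of_pos hb hm) hq
    have k3 : p * (a * Real.log a) + (1 - p) * (b * Real.log b) - m * Real.log m ≤
        p * (a * (a / m - 1)) + (1 - p) * (b * (b / m - 1)) := by
      have : m * Real.log m = p * (a * Real.log m) + (1 - p) * (b * Real.log m) := by
        nth_rw 1 [hmd]; ring
      linarith
    refine k3.trans ?_
    -- The bound `log t ≤ t - 1` has replaced the entropy by the variance divided by the mean.
    have k4 : p * (a * (a / m - 1)) + (1 - p) * (b * (b / m - 1)) =
        p * (1 - p) * (a - b) ^ 2 / m := by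
      field_simp
      rw [hmd]; ring
    rw [k4, div_le_iff₀ hm, hmd]
    obtain ⟨s, hs⟩ : ∃ s, s = √a := ⟨_, rfl⟩
    obtain ⟨t, ht⟩ : ∃ t, t = √b := ⟨_, rfl⟩
    have ea : a = s ^ 2 := by rw [hs, Real.sq_sqrt ha]
    have eb : b = t ^ 2 := by rw [ht, Real.sq_sqrt hb]
    rw [← hs, ← ht, ea, eb]
    have k5 : p * (1 - p) * (s + t) ^ 2 ≤ 2 * (p * s ^ 2 + (1 - p) * t ^ 2) := by
      nlinarith [mul_nonneg (mul_nonneg h0 hq) (sq_nonneg (s - t)),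
        mul_nonneg (mul_nonneg h0 h0) (sq_nonneg s), mul_nonneg (mul_nonneg hq hq) (sq_nonneg t)]
    calc p * (1 - p) * (s ^ 2 - t ^ 2) ^ 2 = (s - t) ^ 2 * (p * (1 - p) * (s + t) ^ 2) := by ring
      _ ≤ (s - t) ^ 2 * (2 * (p * s ^ 2 + (1 - p) * t ^ 2)) :=
          mul_le_mul_of_nonneg_left k5 (sq_nonneg _)
      _ = _ := by ring

/-- Joint convexity of `(√a - √c) ^ 2`: after expansion it is Cauchy–Schwarz for the cross term. It
lets averages be pulled out of the energy of a square root. -/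
theorem sqrt_sub_sqrt_sq_le {p a b c d : ℝ} (h0 : 0 ≤ p) (h1 : p ≤ 1) (ha : 0 ≤ a) (hb : 0 ≤ b)
    (hc : 0 ≤ c) (hd : 0 ≤ d) :
    (√(p * a + (1 - p) * b) - √(p * c + (1 - p) * d)) ^ 2 ≤
      p * (√a - √c) ^ 2 + (1 - p) * (√b - √d) ^ 2 := by
  have hq : 0 ≤ 1 - p := sub_nonneg.2 h1
  have hab : 0 ≤ p * a + (1 - p) * b := by positivity
  have hcd : 0 ≤ p * c + (1 - p) * d := by positivity
  have hCS : p * (√a * √c) + (1 - p) * (√b * √d) ≤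
      √(p * a + (1 - p) * b) * √(p * c + (1 - p) * d) := by
    rw [← Real.sqrt_mul hab]
    refine Real.le_sqrt_of_sq_le ?_
    have e : (p * a + (1 - p) * b) * (p * c + (1 - p) * d) =
        (p * √a ^ 2 + (1 - p) * √b ^ 2) * (p * √c ^ 2 + (1 - p) * √d ^ 2) := by
      rw [Real.sq_sqrt ha, Real.sq_sqrt hb, Real.sq_sqrt hc, Real.sq_sqrt hd]
    rw [e]
    nlinarith [mul_nonneg (mul_nonneg h0 hq) (sq_nonneg (√a * √d - √b * √c))]
  rw [sub_sq, sub_sq, sub_sq, Real.sq_sqrt hab, Real.sq_sqrt hcd, Real.sq_sqrt ha, Real.sq_sqrt hb,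
    Real.sq_sqrt hc, Real.sq_sqrt hd]
  linarith

variable [DecidableEq ι]

theorem avgList_mono {p : ℝ} (h0 : 0 ≤ p) (h1 : p ≤ 1) (l : List ι) {f g : (ι → Bool) → ℝ}
    (h : ∀ x, f x ≤ g x) (x : ι → Bool) : avgList p l f x ≤ avgList p l g x := by
  induction l generalizing x with
  | nil => exact h x
  | cons k l ih => exact avg_mono h0 h1 k ih x

theorem avgList_zero (p : ℝ) (l : List ι) : avgList p l (fun _ => 0) = fun _ => 0 := by
  induction l with
  | nil => rfl
  | cons k l ih =>
    change avg p k (avgList p l fun _ => 0) = _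
    rw [ih]
    ext x; simp [avg]

theorem avgList_nonneg {p : ℝ} (h0 : 0 ≤ p) (h1 : p ≤ 1) (l : List ι) {f : (ι → Bool) → ℝ}
    (h : ∀ x, 0 ≤ f x) (x : ι → Bool) : 0 ≤ avgList p l f x := by
  simpa [avgList_zero] using avgList_mono h0 h1 l h x

theorem abs_avgList_le {p : ℝ} (h0 : 0 ≤ p) (h1 : p ≤ 1) (l : List ι) (f : (ι → Bool) → ℝ)
    (x : ι → Bool) : |avgList p l f x| ≤ avgList p l (fun y => |f y|) x := by
  induction l generalizing x with
  | nil => exact le_rfl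
  | cons k l ih =>
    refine le_trans ?_ (avg_mono h0 h1 k ih x)
    refine (abs_add_le _ _).trans (le_of_eq ?_)
    rw [abs_mul, abs_mul, abs_of_nonneg h0, abs_of_nonneg (sub_nonneg.2 h1)]
    rfl

theorem diff_sqrt_avgList_sq_le {p : ℝ} (h0 : 0 ≤ p) (h1 : p ≤ 1) {k : ι} {l : List ι}
    (hk : k ∉ l) {F : (ι → Bool) → ℝ} (hF : ∀ x, 0 ≤ F x) (x : ι → Bool) :
    diff k (fun y => √(avgList p l F y)) x ^ 2 ≤
      avgList p l (fun y => diff k (fun z => √(F z)) y ^ 2) x := by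
  induction l generalizing x with
  | nil => exact le_rfl
  | cons i l ih =>
    rw [List.mem_cons, not_or] at hk
    have hn := avgList_nonneg h0 h1 l hF
    refine le_trans ?_ (avg_mono h0 h1 i (ih hk.2) x)
    change (√(avg p i (avgList p l F) _) - √(avg p i (avgList p l F) _)) ^ 2 ≤ _
    simp only [avg, diff, update_comm hk.1]
    exact sqrt_sub_sqrt_sq_le h0 h1 (hn _) (hn _) (hn _) (hn _)

variable [Fintype ι]

/-- Tensorization: each further averaging costs a mean of two-point entropies, and convexity bounds
its energy by that of the original function. -/
theorem entropy_avgList_le {p : ℝ} (h0 : 0 ≤ p) (h1 : p ≤ 1) {l : List ι} (hl : l.Nodup)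
    {F : (ι → Bool) → ℝ} (hF : ∀ x, 0 ≤ F x) :
    mean p (fun x => F x * Real.log (F x)) -
      mean p (fun x => avgList p l F x * Real.log (avgList p l F x)) ≤
      2 * (l.map fun k => mean p fun x => diff k (fun y => √(F y)) x ^ 2).sum := by
  induction l with
  | nil => simp [avgList]
  | cons k l ih =>
    rw [List.nodup_cons] at hl
    have hn := avgList_nonneg h0 h1 l hF
    have h2 : mean p (fun x => avgList p l F x * Real.log (avgList p l F x)) -
        mean p (fun x => avgList p (k :: l) F x * Real.log (avgList p (k :: l) F x)) ≤
        2 * mean p fun x => diff k (fun y => √(F y)) x ^ 2 := by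
      rw [← mean_avg p k, ← mean_sub, ← mean_avgList p l fun x => diff k _ x ^ 2,
        ← mean_const_mul]
      refine mean_mono h0 h1 fun x => le_trans ?_
        (mul_le_mul_of_nonneg_left (diff_sqrt_avgList_sq_le h0 h1 hl.1 hF x) zero_le_two)
      exact two_point_log_sobolev h0 h1 (hn _) (hn _)
    rw [List.map_cons, List.sum_cons]
    linarith [ih hl.2]

/-- The logarithmic Sobolev inequality on the biased cube. -/
theorem log_sobolev {p : ℝ} (h0 : 0 ≤ p) (h1 : p ≤ 1) (g : (ι → Bool) → ℝ) :
    mean p (fun x => g x ^ 2 * Real.log (g x ^ 2)) -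
      mean p (fun x => g x ^ 2) * Real.log (mean p fun x => g x ^ 2) ≤
      2 * ∑ k, mean p fun x => diff k g x ^ 2 := by
  have h := entropy_avgList_le h0 h1 (nodup_toList (univ : Finset ι))
    (F := fun x => g x ^ 2) (fun x => sq_nonneg _)
  simp only [avgList_univ, mean_const, sum_map_toList] at h
  refine h.trans (mul_le_mul_of_nonneg_left (sum_le_sum fun k _ =>
    mean_mono h0 h1 fun x => ?_) zero_le_two)
  simp only [diff, Real.sqrt_sq_eq_abs]
  exact sq_le_sq.2 (abs_abs_sub_abs_le_abs_sub _ _)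

/-- A lower bound for the entropy of `g ^ 2` in terms of the first two absolute moments of `g`. -/
theorem le_entropy_sq {p : ℝ} (h0 : 0 ≤ p) (h1 : p ≤ 1) {L : ℝ} (hL : 0 < L)
    (g : (ι → Bool) → ℝ) :
    mean p (fun x => g x ^ 2) * (1 + Real.log L) - L * mean p (fun x => |g x|) ^ 2 ≤
      mean p (fun x => g x ^ 2 * Real.log (g x ^ 2)) -
        mean p (fun x => g x ^ 2) * Real.log (mean p fun x => g x ^ 2) := by
  obtain ⟨A, hA⟩ : ∃ A, A = mean p fun x => g x ^ 2 := ⟨_, rfl⟩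
  obtain ⟨B, hB⟩ : ∃ B, B = mean p fun x => |g x| := ⟨_, rfl⟩
  have hA0 : 0 ≤ A := hA ▸ mean_nonneg h0 h1 fun x => sq_nonneg _
  -- Pointwise this is `log (c / |g|) ≤ c / |g| - 1` multiplied by `2 * g ^ 2`; the scale `c`
  -- remains free.
  have key : ∀ c, 0 < c → A * Real.log (c ^ 2) + 2 * A - 2 * c * B ≤
      mean p (fun x => g x ^ 2 * Real.log (g x ^ 2)) := by
    intro c hc
    have e : A * Real.log (c ^ 2) + 2 * A - 2 * c * B =
        mean p fun x => (Real.log (c ^ 2) + 2) * g x ^ 2 - (2 * c) * |g x| := by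
      rw [mean_sub, mean_const_mul, mean_const_mul, ← hA, ← hB]; ring
    rw [e]
    refine mean_mono h0 h1 fun x => ?_
    rcases (abs_nonneg (g x)).eq_or_lt with h | h
    · have hg : g x = 0 := abs_eq_zero.1 h.symm
      simp [hg]
    · have h3 := Real.log_le_sub_one_of_pos (div_pos hc h)
      rw [Real.log_div hc.ne' h.ne'] at h3
      have h4 := mul_le_mul_of_nonneg_left h3 (sq_nonneg |g x|)
      rw [← sq_abs (g x), Real.log_pow, Real.log_pow]
      have h5 : |g x| ^ 2 * (c / |g x| - 1) = c * |g x| - |g x| ^ 2 := by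
        field_simp
      rw [h5] at h4
      push_cast
      linarith
  rw [← hA, ← hB]
  rcases hA0.eq_or_lt with h | h
  · have h6 : 0 ≤ mean p (fun x => g x ^ 2 * Real.log (g x ^ 2)) := by
      by_contra! hlt
      have hB0 : 0 ≤ B := hB ▸ mean_nonneg h0 h1 fun x => abs_nonneg _
      obtain ⟨e, he⟩ : ∃ e, e = mean p (fun x => g x ^ 2 * Real.log (g x ^ 2)) := ⟨_, rfl⟩
      rw [← he] at hlt key
      have he0 : e < 0 := by linarith
      -- With `A = 0` the bound reads `-2 * c * B ≤ e`; this `c` is small enough to give `e / 2 ≤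
      -- e`, impossible for `e < 0`.
      have h7 := key (-e / (4 * (B + 1))) (by apply div_pos <;> linarith)
      rw [← h] at h7
      have h8 : -e / (4 * (B + 1)) * B ≤ -e / 4 := by
        rw [div_mul_eq_mul_div, div_le_div_iff₀ (by linarith) (by norm_num)]
        nlinarith
      linarith
    rw [← h]
    nlinarith [mul_nonneg hL.le (sq_nonneg B)]
  -- This scale turns `log (c ^ 2)` into `log L + log A`, and AM–GM splits the cross term.
  · have h9 := key (√(L * A)) (by positivity)
    rw [Real.sq_sqrt (by positivity), Real.log_mul hL.ne' h.ne'] at h9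
    have h10 : 2 * √(L * A) * B ≤ A + L * B ^ 2 := by
      rw [Real.sqrt_mul hL.le]
      nlinarith [sq_nonneg (√A - √L * B), Real.sq_sqrt h.le, Real.sq_sqrt hL.le]
    linarith

/-- The energies of the martingale increments telescope: `diff i` commutes with averaging over `k ≠
i`, so Pythagoras applies, and for `i = k` the averaged term has zero derivative. -/
theorem mean_sq_martingale_diff {p : ℝ} {k : ι} {l : List ι}
    (f : (ι → Bool) → ℝ) (i : ι) :
    mean p (fun x => diff i (fun y => avgList p l f y - avgList p (k :: l) f y) x ^ 2) =
      mean p (fun x => diff i (avgList p l f) x ^ 2) -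
        mean p (fun x => diff i (avgList p (k :: l) f) x ^ 2) := by
  have hd : diff i (fun y => avgList p l f y - avgList p (k :: l) f y) =
      fun x => diff i (avgList p l f) x - diff i (avgList p (k :: l) f) x := by
    ext x; simp only [diff]; ring
  rw [hd]
  by_cases hi : i = k
  · subst hi
    have h2 : diff i (avgList p (i :: l) f) = fun _ => 0 := diff_avg_self p i _
    simp [h2, mean_const]
  · have h2 : diff i (avgList p (k :: l) f) = avg p k (diff i (avgList p l f)) :=
      diff_avg_of_ne p hi _
    rw [h2, mean_sq_sub_mean_avg_sq]

/-- Each martingale increment satisfies the entropy lower bound and the logarithmic Sobolev upper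
bound. Summed over the list, variances and energies telescope, and only the squared `L¹` norms
remain as a sum. -/
theorem variance_avgList_le {p : ℝ} (h0 : 0 ≤ p) (h1 : p ≤ 1) {L : ℝ} (hL : 0 < L)
    {l : List ι} (hl : l.Nodup) (f : (ι → Bool) → ℝ) :
    (mean p (fun x => f x ^ 2) - mean p (fun x => avgList p l f x ^ 2)) * (1 + Real.log L) ≤
      2 * ∑ i, (mean p (fun x => diff i f x ^ 2) -
        mean p (fun x => diff i (avgList p l f) x ^ 2)) +
      L * (l.map fun k => mean p (fun x => |diff k f x|) ^ 2).sum := by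
  induction l with
  | nil => simp [avgList]
  | cons k l ih =>
    rw [List.nodup_cons] at hl
    have ih := ih hl.2
    obtain ⟨g, hg⟩ : ∃ g : (ι → Bool) → ℝ,
      g = fun y => avgList p l f y - avgList p (k :: l) f y := ⟨_, rfl⟩
    have hE := (le_entropy_sq h0 h1 hL g).trans (log_sobolev h0 h1 g)
    have e1 : mean p (fun x => g x ^ 2) =
        mean p (fun x => avgList p l f x ^ 2) - mean p (fun x => avgList p (k :: l) f x ^ 2) := by
      rw [hg]; exact mean_sq_sub_mean_avg_sq p k _
    have e2 : ∀ i, mean p (fun x => diff i g x ^ 2) =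
        mean p (fun x => diff i (avgList p l f) x ^ 2) -
        mean p (fun x => diff i (avgList p (k :: l) f) x ^ 2) := by
      rw [hg]; exact mean_sq_martingale_diff f
    -- On a fibre in direction `k` the increment takes the values `(1 - p) * δ` and `-p * δ`, where
    -- `δ` is the derivative of the averaged function; its mean modulus is `2 * p * (1 - p) * |δ| ≤
    -- |δ|`.
    have e3 : mean p (fun x => |g x|) ≤ mean p fun x => |diff k f x| := by
      rw [← mean_avgList p l fun x => |diff k f x|]
      rw [← mean_avg p k]
      refine mean_mono h0 h1 fun x => le_trans ?_ (abs_avgList_le h0 h1 l (diff k f) x)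
      rw [← diff_avgList_of_notMem p hl.1]
      have g1 : g (update x k true) = (1 - p) * diff k (avgList p l f) x := by
        rw [hg]
        change _ - avg p k (avgList p l f) _ = _
        simp [avg, diff]; ring
      have g0 : g (update x k false) = -(p * diff k (avgList p l f) x) := by
        rw [hg]
        change _ - avg p k (avgList p l f) _ = _
        simp [avg, diff]; ring
      have hq : 0 ≤ 1 - p := sub_nonneg.2 h1
      simp only [avg, g1, g0, abs_neg, abs_mul, abs_of_nonneg h0, abs_of_nonneg hq]
      have hpq : 2 * (p * (1 - p)) ≤ 1 := by nlinarith [sq_nonneg (p - (1 - p))]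
      nlinarith [mul_le_mul_of_nonneg_right hpq (abs_nonneg (diff k (avgList p l f) x))]
    have e4 : mean p (fun x => |g x|) ^ 2 ≤ mean p (fun x => |diff k f x|) ^ 2 :=
      pow_le_pow_left₀ (mean_nonneg h0 h1 fun x => abs_nonneg _) e3 2
    rw [e1] at hE
    simp only [e2] at hE
    rw [List.map_cons, List.sum_cons]
    simp only [sum_sub_distrib] at hE ih ⊢
    have e5 := mul_le_mul_of_nonneg_left e4 hL.le
    linarith

/-- An inequality of Talagrand type between the variance and the influences. -/
theorem variance_mul_log_le {p : ℝ} (h0 : 0 ≤ p) (h1 : p ≤ 1) {L : ℝ} (hL : 0 < L)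
    (f : (ι → Bool) → ℝ) :
    (mean p (fun x => f x ^ 2) - mean p f ^ 2) * (1 + Real.log L) ≤
      2 * ∑ i, mean p (fun x => diff i f x ^ 2) +
      L * ∑ i, mean p (fun x => |diff i f x|) ^ 2 := by
  have h := variance_avgList_le h0 h1 hL (nodup_toList (univ : Finset ι)) f
  simpa [avgList_univ, mean_const, diff_avgList_of_mem, diff, sum_map_toList] using h

end BiasedCube

/-! ### The endpoints `p = 0` and `p = 1` -/

namespace BiasedCube

open Finset

variable {ι : Type*} [Fintype ι] [DecidableEq ι]

theorem mean_one (f : (ι → Bool) → ℝ) : mean 1 f = f fun _ => true := by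
  rw [mean, Fintype.sum_eq_single fun _ => true]
  · simp [weight]
  · intro x hx
    obtain ⟨i, hi⟩ := Function.ne_iff.1 hx
    rw [weight, prod_eq_zero (mem_univ i) (by simpa using hi), zero_mul]

theorem mean_zero (f : (ι → Bool) → ℝ) : mean 0 f = f fun _ => false := by
  rw [mean, Fintype.sum_eq_single fun _ => false]
  · simp [weight]
  · intro x hx
    obtain ⟨i, hi⟩ := Function.ne_iff.1 hx
    rw [weight, prod_eq_zero (mem_univ i) (by simpa using hi), zero_mul]

end BiasedCube

/-! ### EXIT functions: area theorem and sharp threshold -/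

namespace BinaryLinearCode

open Finset BiasedCube Function

variable {N : ℕ}

open Classical in
/-- The indicator of the event that the `i`-th bit is not determined by the other received bits,
where `x j = true` means that the `j`-th bit is received. -/
def exitIndicator (C : BinaryLinearCode N) (i : Fin N) (x : Fin N → Bool) : ℝ :=
  if ∃ c ∈ C, (∀ j, j ≠ i → x j = true → c j = 0) ∧ c i ≠ 0 then 1 else 0

/-- The EXIT function of the `i`-th bit: the probability that this bit is not determined by the
other received bits, when every bit is received with probability `p`. -/
def exit (C : BinaryLinearCode N) (i : Fin N) (p : ℝ) : ℝ := mean p (C.exitIndicator i)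

/-- The codewords that vanish on the received positions. -/
def vanishing (C : BinaryLinearCode N) (x : Fin N → Bool) : BinaryLinearCode N where
  carrier := {c | c ∈ C ∧ ∀ j, x j = true → c j = 0}
  zero_mem' := ⟨C.zero_mem, fun _ _ => rfl⟩
  add_mem' := by
    rintro a b ⟨ha, ha'⟩ ⟨hb, hb'⟩
    exact ⟨C.add_mem ha hb, fun j hj => by simp [ha' j hj, hb' j hj]⟩
  smul_mem' := by
    rintro r a ⟨ha, ha'⟩
    exact ⟨C.smul_mem r ha, fun j hj => by simp [ha' j hj]⟩

theorem exitIndicator_nonneg (C : BinaryLinearCode N) (i : Fin N) (x : Fin N → Bool) :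
    0 ≤ C.exitIndicator i x := by
  unfold exitIndicator; split_ifs <;> simp

theorem exitIndicator_le_one (C : BinaryLinearCode N) (i : Fin N) (x : Fin N → Bool) :
    C.exitIndicator i x ≤ 1 := by
  unfold exitIndicator; split_ifs <;> simp

theorem exitIndicator_sq (C : BinaryLinearCode N) (i : Fin N) (x : Fin N → Bool) :
    C.exitIndicator i x ^ 2 = C.exitIndicator i x := by
  unfold exitIndicator; split_ifs <;> simp

theorem diff_exitIndicator_self (C : BinaryLinearCode N) (i : Fin N) :
    diff i (C.exitIndicator i) = fun _ => 0 := by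
  ext x
  have h : ∀ b, C.exitIndicator i (update x i b) = C.exitIndicator i x := by
    intro b
    unfold exitIndicator
    congr 1
    simp +contextual [update_of_ne]
  simp [diff, h]

theorem exitIndicator_antitone (C : BinaryLinearCode N) (i : Fin N) {x y : Fin N → Bool}
    (h : ∀ j, x j = true → y j = true) : C.exitIndicator i y ≤ C.exitIndicator i x := by
  by_cases hy : ∃ c ∈ C, (∀ j, j ≠ i → y j = true → c j = 0) ∧ c i ≠ 0
  · have hx : ∃ c ∈ C, (∀ j, j ≠ i → x j = true → c j = 0) ∧ c i ≠ 0 := by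
      obtain ⟨c, hc, h1, h2⟩ := hy
      exact ⟨c, hc, fun j hj hxj => h1 j hj (h j hxj), h2⟩
    simp [exitIndicator, hx, hy]
  · simpa [exitIndicator, hy] using C.exitIndicator_nonneg i x

theorem diff_exitIndicator_nonpos (C : BinaryLinearCode N) (i j : Fin N) (x : Fin N → Bool) :
    diff j (C.exitIndicator i) x ≤ 0 := by
  refine sub_nonpos.2 (C.exitIndicator_antitone i fun k => ?_)
  by_cases hk : k = j
  · subst hk; simp
  · simp [hk]

theorem diff_exitIndicator_sq (C : BinaryLinearCode N) (i j : Fin N) (x : Fin N → Bool) :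
    diff j (C.exitIndicator i) x ^ 2 = |diff j (C.exitIndicator i) x| := by
  unfold diff exitIndicator
  split_ifs <;> simp

theorem finrank_inf_ker_add {V : Type*} [AddCommGroup V] [Module (ZMod 2) V]
    [FiniteDimensional (ZMod 2) V] (W : Submodule (ZMod 2) V) (l : V →ₗ[ZMod 2] ZMod 2)
    [Decidable (∃ c ∈ W, l c ≠ 0)] :
    Module.finrank (ZMod 2) (W ⊓ LinearMap.ker l : Submodule (ZMod 2) V) +
      (if ∃ c ∈ W, l c ≠ 0 then 1 else 0) = Module.finrank (ZMod 2) W := by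
  split_ifs with h
  · obtain ⟨c, hc, hlc⟩ := h
    have hne : l.domRestrict W ≠ 0 := fun h0 => hlc (LinearMap.congr_fun h0 ⟨c, hc⟩)
    rw [← Module.Dual.finrank_ker_add_one_of_ne_zero (f := l.domRestrict W) hne]
    congr 1
    have : LinearMap.ker (l.domRestrict W) = (W ⊓ LinearMap.ker l).comap W.subtype := by
      ext x; simp
    rw [this]
    exact (Submodule.comapSubtypeEquivOfLe inf_le_left).finrank_eq.symm
  · push Not at h
    rw [inf_eq_left.2 fun c hc => LinearMap.mem_ker.2 (h c hc), add_zero]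

/-- Receiving bit `i` intersects the vanishing subcode with a coordinate hyperplane, which lowers
the dimension by one exactly when bit `i` was undetermined. This is the combinatorial core of the
area theorem. -/
theorem diff_finrank_vanishing (C : BinaryLinearCode N) (i : Fin N) :
    diff i (fun x => -(Module.finrank (ZMod 2) (C.vanishing x) : ℝ)) = C.exitIndicator i := by
  classical
  ext x
  have h1 : C.vanishing (update x i true) =
      C.vanishing (update x i false) ⊓ LinearMap.ker (LinearMap.proj i) := by
    ext c
    constructor
    · rintro ⟨hc, h⟩
      refine ⟨⟨hc, fun j hj => h j ?_⟩, h i (by simp)⟩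
      by_cases hji : j = i
      · subst hji; simp at hj
      · simpa [hji] using hj
    · rintro ⟨⟨hc, h⟩, hi⟩
      refine ⟨hc, fun j hj => ?_⟩
      by_cases hji : j = i
      · subst hji; exact hi
      · exact h j (by simpa [hji] using hj)
  have h2 := finrank_inf_ker_add (C.vanishing (update x i false)) (LinearMap.proj i)
  rw [← h1] at h2
  have h3 : (∃ c ∈ C.vanishing (update x i false),
      (LinearMap.proj i : (Fin N → ZMod 2) →ₗ[ZMod 2] ZMod 2) c ≠ 0) ↔
      ∃ c ∈ C, (∀ j, j ≠ i → x j = true → c j = 0) ∧ c i ≠ 0 := by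
    constructor
    · rintro ⟨c, ⟨hc, h⟩, hci⟩
      exact ⟨c, hc, fun j hj hx => h j (by simpa [hj] using hx), hci⟩
    · rintro ⟨c, hc, h, hci⟩
      refine ⟨c, ⟨hc, fun j hj => ?_⟩, hci⟩
      by_cases hji : j = i
      · subst hji; simp at hj
      · exact h j hji (by simpa [hji] using hj)
  simp only [h3] at h2
  simp only [diff, exitIndicator]
  rw [← h2]
  push_cast
  ring

theorem exit_nonneg (C : BinaryLinearCode N) (i : Fin N) {p : ℝ} (h0 : 0 ≤ p) (h1 : p ≤ 1) :
    0 ≤ C.exit i p :=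
  mean_nonneg h0 h1 (C.exitIndicator_nonneg i)

theorem exit_le_one (C : BinaryLinearCode N) (i : Fin N) {p : ℝ} (h0 : 0 ≤ p) (h1 : p ≤ 1) :
    C.exit i p ≤ 1 :=
  (mean_mono h0 h1 (C.exitIndicator_le_one i)).trans_eq (mean_const p 1)

theorem hasDerivAt_mean_finrank_vanishing (C : BinaryLinearCode N) (p : ℝ) :
    HasDerivAt (fun t => mean t fun x => -(Module.finrank (ZMod 2) (C.vanishing x) : ℝ))
      (∑ i, C.exit i p) p := by
  have h := hasDerivAt_mean p fun x => -(Module.finrank (ZMod 2) (C.vanishing x) : ℝ)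
  simp only [diff_finrank_vanishing] at h
  exact h

theorem vanishing_true (C : BinaryLinearCode N) : C.vanishing (fun _ => true) = ⊥ := by
  refine (Submodule.eq_bot_iff _).2 fun c hc => ?_
  ext j
  exact hc.2 j rfl

theorem vanishing_false (C : BinaryLinearCode N) : C.vanishing (fun _ => false) = C := by
  ext c
  exact ⟨fun h => h.1, fun h => ⟨h, fun j hj => by simp at hj⟩⟩

/-- The influence of the `j`-th received bit on the `i`-th EXIT function. -/
def exitInfluence (C : BinaryLinearCode N) (i j : Fin N) (p : ℝ) : ℝ :=
  mean p fun x => |diff j (C.exitIndicator i) x|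

theorem exitInfluence_nonneg (C : BinaryLinearCode N) (i j : Fin N) {p : ℝ} (h0 : 0 ≤ p)
    (h1 : p ≤ 1) : 0 ≤ C.exitInfluence i j p :=
  mean_nonneg h0 h1 fun _ => abs_nonneg _

theorem exitInfluence_self (C : BinaryLinearCode N) (i : Fin N) (p : ℝ) :
    C.exitInfluence i i p = 0 := by
  simp [exitInfluence, diff_exitIndicator_self, mean_const]

theorem hasDerivAt_exit (C : BinaryLinearCode N) (i : Fin N) (p : ℝ) :
    HasDerivAt (C.exit i) (-∑ j, C.exitInfluence i j p) p := by
  refine (hasDerivAt_mean p (C.exitIndicator i)).congr_deriv ?_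
  rw [← sum_neg_distrib]
  refine sum_congr rfl fun j _ => ?_
  have h : diff j (C.exitIndicator i) = fun x => (-1) * |diff j (C.exitIndicator i) x| := by
    ext x
    rw [abs_of_nonpos (C.diff_exitIndicator_nonpos i j x)]; ring
  rw [h, mean_const_mul, exitInfluence]
  ring

theorem exit_antitoneOn (C : BinaryLinearCode N) (i : Fin N) :
    AntitoneOn (C.exit i) (Set.Icc 0 1) := by
  refine antitoneOn_of_deriv_nonpos (convex_Icc 0 1)
    (fun t _ => (C.hasDerivAt_exit i t).continuousAt.continuousWithinAt)
    (fun t _ => (C.hasDerivAt_exit i t).differentiableAt.differentiableWithinAt) fun t ht => ?_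
  rw [interior_Icc] at ht
  rw [(C.hasDerivAt_exit i t).deriv]
  exact neg_nonpos.2 (sum_nonneg fun j _ => C.exitInfluence_nonneg i j ht.1.le ht.2.le)

theorem exit_variance_le (C : BinaryLinearCode N) (i : Fin N) {p : ℝ} (h0 : 0 ≤ p) (h1 : p ≤ 1)
    {L : ℝ} (hL : 0 < L) :
    C.exit i p * (1 - C.exit i p) * (1 + Real.log L) ≤
      2 * ∑ j, C.exitInfluence i j p + L * ∑ j, C.exitInfluence i j p ^ 2 := by
  have h := variance_mul_log_le h0 h1 hL (C.exitIndicator i)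
  simp only [exitIndicator_sq, diff_exitIndicator_sq] at h
  refine le_trans (le_of_eq ?_) h
  rw [exit]; ring

theorem exitIndicator_comp {C : BinaryLinearCode N} {π : Equiv.Perm (Fin N)}
    (hπ : ∀ x : Fin N → ZMod 2, x ∈ C ↔ (fun i => x (π i)) ∈ C) (i : Fin N) (x : Fin N → Bool) :
    C.exitIndicator i (x ∘ π) = C.exitIndicator (π i) x := by
  have h : (∃ c ∈ C, (∀ j, j ≠ i → (x ∘ π) j = true → c j = 0) ∧ c i ≠ 0) ↔
      ∃ c ∈ C, (∀ j, j ≠ π i → x j = true → c j = 0) ∧ c (π i) ≠ 0 := by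
    constructor
    · rintro ⟨c, hc, h, hi⟩
      refine ⟨fun j => c (π.symm j), (hπ _).2 (by simpa using hc), fun j hj hx => ?_, by simpa using hi⟩
      exact h _ (fun hji => hj (by rw [← hji]; simp)) (by simpa using hx)
    · rintro ⟨c, hc, h, hi⟩
      exact ⟨fun j => c (π j), (hπ c).1 hc,
        fun j hj hx => h _ (fun hji => hj (π.injective hji)) hx, hi⟩
  unfold exitIndicator
  congr 1
  exact propext h

theorem exit_perm {C : BinaryLinearCode N} {π : Equiv.Perm (Fin N)}
    (hπ : ∀ x : Fin N → ZMod 2, x ∈ C ↔ (fun i => x (π i)) ∈ C) (i : Fin N) (p : ℝ) :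
    C.exit (π i) p = C.exit i p := by
  rw [exit, exit, ← mean_comp_perm p π (C.exitIndicator i)]
  simp only [exitIndicator_comp hπ]

theorem exitInfluence_perm {C : BinaryLinearCode N} {π : Equiv.Perm (Fin N)}
    (hπ : ∀ x : Fin N → ZMod 2, x ∈ C ↔ (fun i => x (π i)) ∈ C) (i j : Fin N) (p : ℝ) :
    C.exitInfluence (π i) (π j) p = C.exitInfluence i j p := by
  rw [exitInfluence, exitInfluence,
    ← mean_comp_perm p π fun x => |diff j (C.exitIndicator i) x|]
  congr 1
  ext x
  have hu : ∀ b, update (x ∘ π) j b = update x (π j) b ∘ π := fun b => by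
    ext k; simp [update_apply]
  simp only [diff, hu, exitIndicator_comp hπ]

theorem IsTwoTransitive.exit_eq {C : BinaryLinearCode N} (hC : C.IsTwoTransitive) (hN : 2 ≤ N)
    (i j : Fin N) (p : ℝ) : C.exit i p = C.exit j p := by
  have : Nontrivial (Fin N) := Fin.nontrivial_iff_two_le.2 hN
  obtain ⟨i', hi⟩ := exists_ne i
  obtain ⟨j', hj⟩ := exists_ne j
  obtain ⟨π, h1, -, h⟩ := hC i i' j j' hi.symm hj.symm
  rw [← h1, exit_perm h]

theorem IsTwoTransitive.exitInfluence_eq {C : BinaryLinearCode N} (hC : C.IsTwoTransitive)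
    {i j k : Fin N} (hj : j ≠ i) (hk : k ≠ i) (p : ℝ) :
    C.exitInfluence i j p = C.exitInfluence i k p := by
  obtain ⟨π, h1, h2, h⟩ := hC i j i k hj.symm hk.symm
  have := exitInfluence_perm h i j p
  rw [← this, h1, h2]

/-- The influence of `i` on itself is zero and the other `N - 1` are equal, so Cauchy–Schwarz holds
with equality. -/
theorem IsTwoTransitive.mul_sum_exitInfluence_sq {C : BinaryLinearCode N}
    (hC : C.IsTwoTransitive) (i : Fin N) (p : ℝ) :
    ((N : ℝ) - 1) * ∑ j, C.exitInfluence i j p ^ 2 = (∑ j, C.exitInfluence i j p) ^ 2 := by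
  have hs : ∀ f : Fin N → ℝ, f i = 0 → ∑ j, f j = ∑ j ∈ univ.erase i, f j := fun f hf => by
    rw [← add_sum_erase univ f (mem_univ i), hf, zero_add]
  rw [hs (fun j => C.exitInfluence i j p) (C.exitInfluence_self i p),
    hs (fun j => C.exitInfluence i j p ^ 2) (by simp [C.exitInfluence_self i p])]
  have hcard : ((univ.erase i : Finset (Fin N)).card : ℝ) = (N : ℝ) - 1 := by
    rw [card_erase_of_mem (mem_univ i), card_univ, Fintype.card_fin, Nat.cast_pred i.pos]
  rcases (univ.erase i : Finset (Fin N)).eq_empty_or_nonempty with h | ⟨k, hk⟩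
  · simp [h]
  · have hb : ∀ j ∈ univ.erase i, C.exitInfluence i j p = C.exitInfluence i k p := fun j hj =>
      hC.exitInfluence_eq (ne_of_mem_erase hj) (ne_of_mem_erase hk) p
    rw [sum_congr rfl hb, sum_congr rfl fun j hj => by rw [hb j hj], sum_const, sum_const,
      nsmul_eq_mul, nsmul_eq_mul, hcard]
    ring

/-- The EXIT function of a 2-transitive code is steep wherever it is bounded away from `0`
and `1`. -/
theorem IsTwoTransitive.exit_variance_mul_log_le {C : BinaryLinearCode N}
    (hC : C.IsTwoTransitive) (hN : 2 ≤ N) (i : Fin N) {p : ℝ} (h0 : 0 ≤ p) (h1 : p ≤ 1) :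
    C.exit i p * (1 - C.exit i p) * Real.log ((N : ℝ) - 1) ≤
      2 * (∑ j, C.exitInfluence i j p) + (∑ j, C.exitInfluence i j p) ^ 2 := by
  have hN' : (2 : ℝ) ≤ N := by exact_mod_cast hN
  -- This `L` turns the sum of squared influences into the square of the total influence.
  have h := C.exit_variance_le i h0 h1 (L := (N : ℝ) - 1) (by linarith)
  rw [hC.mul_sum_exitInfluence_sq i p] at h
  have hv := mul_nonneg (C.exit_nonneg i h0 h1) (sub_nonneg.2 (C.exit_le_one i h0 h1))
  linarith

/-- The area theorem, as a lower bound: if the EXIT function at `p` is at least `a`, then the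
rate is at least `a * p`. -/
theorem IsTwoTransitive.mul_le_rate {C : BinaryLinearCode N} (hC : C.IsTwoTransitive)
    (hN : 2 ≤ N) (i : Fin N) {p a : ℝ} (h0 : 0 ≤ p) (h1 : p ≤ 1) (ha : a ≤ C.exit i p) :
    a * p ≤ C.rate := by
  have hN' : (2 : ℝ) ≤ N := by exact_mod_cast hN
  obtain ⟨φ, hφ⟩ : ∃ φ : ℝ → ℝ, φ = fun t =>
    mean t fun x => -(Module.finrank (ZMod 2) (C.vanishing x) : ℝ) := ⟨_, rfl⟩
  have hd : ∀ t, HasDerivAt φ (N * C.exit i t) t := fun t => by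
    have h := C.hasDerivAt_mean_finrank_vanishing t
    rw [hφ]
    refine h.congr_deriv ?_
    rw [sum_congr rfl fun j _ => hC.exit_eq hN j i t]
    simp
  have hcont : ∀ s, ContinuousOn φ s := fun s t _ => (hd t).continuousAt.continuousWithinAt
  have hdiff : ∀ s, DifferentiableOn ℝ φ s := fun s t _ =>
    (hd t).differentiableAt.differentiableWithinAt
  have e1 : N * a * (p - 0) ≤ φ p - φ 0 := by
    refine (convex_Icc (0 : ℝ) p).mul_sub_le_image_sub_of_le_deriv (hcont _) (hdiff _)
      (fun t ht => ?_) 0 (by simp [h0]) p (by simp [h0]) h0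
    rw [interior_Icc] at ht
    rw [(hd t).deriv]
    exact mul_le_mul_of_nonneg_left
      (ha.trans (C.exit_antitoneOn i ⟨ht.1.le, ht.2.le.trans h1⟩ ⟨h0, h1⟩ ht.2.le)) (by linarith)
  have e2 : 0 * (1 - p) ≤ φ 1 - φ p := by
    refine (convex_Icc p (1 : ℝ)).mul_sub_le_image_sub_of_le_deriv (hcont _) (hdiff _)
      (fun t ht => ?_) p (by simp [h1]) 1 (by simp [h1]) h1
    rw [interior_Icc] at ht
    rw [(hd t).deriv]
    exact mul_nonneg (by linarith) (C.exit_nonneg i (h0.trans ht.1.le) ht.2.le)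
  have e3 : φ 1 - φ 0 = Module.finrank (ZMod 2) C := by
    simp only [hφ, mean_one, mean_zero]
    rw [vanishing_true, vanishing_false]
    simp
  rw [rate, le_div_iff₀ (by linarith)]
  linarith

/-- A sharp threshold: for large block length, an EXIT function that is at least `δ` at `p₀` is at
least `1 - η` at every smaller `p₁`. -/
theorem IsTwoTransitive.le_exit_of_lt_exit {C : BinaryLinearCode N} (hC : C.IsTwoTransitive)
    (hN : 2 ≤ N) (i : Fin N) {p₁ p₀ δ η D : ℝ} (h0 : 0 ≤ p₁) (h01 : p₁ ≤ p₀) (h1 : p₀ ≤ 1)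
    (hδ : 0 < δ) (hη : 0 ≤ η) (hD0 : 0 ≤ D) (hD : 1 < D * (p₀ - p₁))
    (hlog : 2 * D + D ^ 2 ≤ δ * η * Real.log ((N : ℝ) - 1)) (h : δ ≤ C.exit i p₀) :
    1 - η ≤ C.exit i p₁ := by
  by_contra! hlt
  have hN' : (2 : ℝ) ≤ N := by exact_mod_cast hN
  -- Otherwise the EXIT function lies in `[δ, 1 - η]` on the whole interval. Then `hlog` forces `2 *
  -- D + D ^ 2 ≤ 2 * I + I ^ 2` for the total influence `I`, so `I ≥ D` and the total drop exceeds
  -- 1.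
  have e1 : C.exit i p₀ - C.exit i p₁ ≤ -D * (p₀ - p₁) := by
    refine (convex_Icc p₁ p₀).image_sub_le_mul_sub_of_deriv_le
      (fun t _ => (C.hasDerivAt_exit i t).continuousAt.continuousWithinAt)
      (fun t _ => (C.hasDerivAt_exit i t).differentiableAt.differentiableWithinAt)
      (fun t ht => ?_) p₁ (by simp [h01]) p₀ (by simp [h01]) h01
    rw [interior_Icc] at ht
    have ht0 : 0 ≤ t := h0.trans ht.1.le
    have ht1 : t ≤ 1 := ht.2.le.trans h1
    rw [(C.hasDerivAt_exit i t).deriv]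
    refine neg_le_neg ?_
    have hI := hC.exit_variance_mul_log_le hN i ht0 ht1
    have hI0 : 0 ≤ ∑ j, C.exitInfluence i j t :=
      sum_nonneg fun j _ => C.exitInfluence_nonneg i j ht0 ht1
    have hlow : δ ≤ C.exit i t := h.trans (C.exit_antitoneOn i ⟨ht0, ht1⟩ ⟨h0.trans h01, h1⟩ ht.2.le)
    have hup : η ≤ 1 - C.exit i t := by
      have := C.exit_antitoneOn i ⟨h0, h01.trans h1⟩ ⟨ht0, ht1⟩ ht.1.le
      linarith
    have hlog0 : 0 ≤ Real.log ((N : ℝ) - 1) := Real.log_nonneg (by linarith)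
    have h3 := mul_le_mul_of_nonneg_right (mul_le_mul hlow hup hη (hδ.le.trans hlow)) hlog0
    by_contra! hlt'
    nlinarith
  have := C.exit_le_one i h0 (h01.trans h1)
  linarith

end BinaryLinearCode

/-! ### Affine invariance of extended BCH codes -/

namespace BinaryLinearCode

open Finset

/-- With the parity position placed at the field element `0`, the parity check is the power sum for
`j = 0` (as `0 ^ 0 = 1`), while that position contributes nothing for `j ≥ 1`. The bound `max d 1`
keeps the parity check when `d = 0`. -/
theorem mem_extendedBCH_iff {m : ℕ} (α : GaloisField 2 m) (d : ℕ)
    (e : Fin (2 ^ m - 1 + 1) → GaloisField 2 m)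
    (he : ∀ i : Fin (2 ^ m - 1), e i.castSucc = α ^ (i : ℕ)) (he0 : e (Fin.last _) = 0)
    (c : Fin (2 ^ m - 1 + 1) → ZMod 2) :
    c ∈ extendedBCH m α d ↔ ∀ j : ℕ, j < max d 1 →
      ∑ i, algebraMap (ZMod 2) (GaloisField 2 m) (c i) * e i ^ j = 0 := by
  have hc : c ∈ extendedBCH m α d ↔ (∀ j : ℕ, 1 ≤ j → j < d →
      ∑ i : Fin (2 ^ m - 1), algebraMap (ZMod 2) (GaloisField 2 m) (c i.castSucc) *
        (α ^ j) ^ (i : ℕ) = 0) ∧ ∑ i, c i = 0 := Iff.rfl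
  have hz : ∑ i, algebraMap (ZMod 2) (GaloisField 2 m) (c i) * e i ^ 0 = 0 ↔ ∑ i, c i = 0 := by
    simp only [pow_zero, mul_one, ← map_sum]
    exact map_eq_zero_iff _ (algebraMap (ZMod 2) (GaloisField 2 m)).injective
  have hj : ∀ j, 1 ≤ j → ∑ i, algebraMap (ZMod 2) (GaloisField 2 m) (c i) * e i ^ j =
      ∑ i : Fin (2 ^ m - 1), algebraMap (ZMod 2) (GaloisField 2 m) (c i.castSucc) *
        (α ^ j) ^ (i : ℕ) := by
    intro j hj
    rw [Fin.sum_univ_castSucc, he0, zero_pow (by omega), mul_zero, add_zero]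
    refine sum_congr rfl fun i _ => ?_
    rw [he, ← pow_mul, ← pow_mul, mul_comm j]
  rw [hc, ← hz]
  constructor
  · rintro ⟨h1, h2⟩ j hjd
    rcases Nat.eq_zero_or_pos j with rfl | hj0
    · exact h2
    · rw [hj j hj0]
      exact h1 j hj0 (by omega)
  · intro h
    refine ⟨fun j hj1 hjd => ?_, h 0 (by omega)⟩
    rw [← hj j hj1]
    exact h j (by omega)

theorem exists_equiv_extendedBCH {m : ℕ} (hm : 1 ≤ m) {α : GaloisField 2 m}
    (hα : IsPrimitiveRoot α (2 ^ m - 1)) :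
    ∃ e : Fin (2 ^ m - 1 + 1) ≃ GaloisField 2 m,
      (∀ i : Fin (2 ^ m - 1), e i.castSucc = α ^ (i : ℕ)) ∧ e (Fin.last _) = 0 := by
  have h2 : 2 ≤ 2 ^ m := by simpa using Nat.pow_le_pow_right two_pos hm
  have hα0 : α ≠ 0 := hα.ne_zero (by omega)
  let f : Fin (2 ^ m - 1 + 1) → GaloisField 2 m :=
    Fin.lastCases 0 fun i : Fin (2 ^ m - 1) => α ^ (i : ℕ)
  have hf : ∀ i : Fin (2 ^ m - 1), f i.castSucc = α ^ (i : ℕ) := fun i => by simp [f]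
  have hf0 : f (Fin.last _) = 0 := by simp [f]
  have hinj : Function.Injective f := by
    intro a b
    refine Fin.lastCases ?_ (fun a => ?_) a <;> refine Fin.lastCases ?_ (fun b => ?_) b
    · exact fun _ => rfl
    · rw [hf, hf0]; exact fun h => absurd h.symm (pow_ne_zero _ hα0)
    · rw [hf, hf0]; exact fun h => absurd h (pow_ne_zero _ hα0)
    · rw [hf, hf]; exact fun h => congrArg _ (Fin.ext (hα.pow_inj a.2 b.2 h))
  have : Fintype (GaloisField 2 m) := Fintype.ofFinite _
  have hcard : Fintype.card (Fin (2 ^ m - 1 + 1)) = Fintype.card (GaloisField 2 m) := by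
    rw [← Nat.card_eq_fintype_card (α := GaloisField 2 m), GaloisField.card 2 m (by omega),
      Fintype.card_fin]
    omega
  exact ⟨Equiv.ofBijective f ((Fintype.bijective_iff_injective_and_card f).2 ⟨hinj, hcard⟩), hf, hf0⟩

/-- By the binomial theorem, `(a * x + b) ^ j` is a combination of powers of `x` of degree at most
`j`. -/
theorem sum_mul_affine_pow_eq_zero {ι F : Type*} [Fintype ι] [CommRing F] {D : ℕ} {c e : ι → F}
    (h : ∀ j < D, ∑ i, c i * e i ^ j = 0) (a b : F) :
    ∀ j < D, ∑ i, c i * (a * e i + b) ^ j = 0 := by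
  intro j hj
  simp only [add_pow, mul_sum]
  rw [sum_comm]
  refine sum_eq_zero fun k hk => ?_
  have hk' : k < D := by rw [mem_range] at hk; omega
  calc _ = (a ^ k * b ^ (j - k) * (j.choose k : F)) * ∑ i, c i * e i ^ k := by
        rw [mul_sum]
        exact sum_congr rfl fun i _ => by ring
    _ = 0 := by rw [h k hk', mul_zero]

/-- Extended BCH codes are invariant under the affine group and hence 2-transitive. -/
theorem isTwoTransitive_extendedBCH {m : ℕ} (hm : 1 ≤ m) {α : GaloisField 2 m}
    (hα : IsPrimitiveRoot α (2 ^ m - 1)) (d : ℕ) : (extendedBCH m α d).IsTwoTransitive := by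
  obtain ⟨e, he, he0⟩ := exists_equiv_extendedBCH hm hα
  intro a b c d' hab hcd
  have hab' : e a - e b ≠ 0 := sub_ne_zero.2 fun h => hab (e.injective h)
  have hcd' : e c - e d' ≠ 0 := sub_ne_zero.2 fun h => hcd (e.injective h)
  -- Slope and intercept of the affine map sending `e a` to `e c` and `e b` to `e d'`.
  obtain ⟨s, hs⟩ : ∃ s, s = (e c - e d') / (e a - e b) := ⟨_, rfl⟩
  have hs0 : s ≠ 0 := hs ▸ div_ne_zero hcd' hab'
  obtain ⟨t, ht⟩ : ∃ t, t = e c - s * e a := ⟨_, rfl⟩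
  let A : Equiv.Perm (GaloisField 2 m) := (Equiv.mulLeft₀ s hs0).trans (Equiv.addRight t)
  have hA : ∀ x, A x = s * x + t := fun x => rfl
  have hA' : ∀ x, A.symm x = s⁻¹ * x + -(s⁻¹ * t) := fun x => by
    rw [Equiv.symm_apply_eq, hA]; field_simp; ring
  let π : Equiv.Perm (Fin (2 ^ m - 1 + 1)) := (e.trans A).trans e.symm
  have hπ : ∀ i, e (π i) = s * e i + t := fun i => by simp [π, hA]
  have hπ' : ∀ i, e (π.symm i) = s⁻¹ * e i + -(s⁻¹ * t) := fun i => by simp [π, hA']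
  refine ⟨π, e.injective ?_, e.injective ?_, fun x => ?_⟩
  · rw [hπ, ht]; ring
  · rw [hπ, ht, hs]; field_simp; ring
  · rw [mem_extendedBCH_iff α d e he he0, mem_extendedBCH_iff α d e he he0]
    constructor
    · intro h j hj
      rw [← Equiv.sum_comp π.symm]
      simp only [Equiv.apply_symm_apply, hπ']
      exact sum_mul_affine_pow_eq_zero h _ _ j hj
    · intro h j hj
      rw [← Equiv.sum_comp π]
      simp only [hπ]
      exact sum_mul_affine_pow_eq_zero h _ _ j hj

end BinaryLinearCode

/-! ### From the erasure channel to EXIT functions, and the conclusion -/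

namespace BinaryLinearCode

open Finset BiasedCube Function

variable {N : ℕ}

theorem becTransition_nonneg {ε : ℝ} (h0 : 0 ≤ ε) (h1 : ε ≤ 1) (x : ZMod 2)
    (z : Option (ZMod 2)) : 0 ≤ becTransition ε x z := by
  rcases z with _ | z
  · exact h0
  · simp only [becTransition]
    split_ifs <;> linarith

theorem jointProb_nonneg (C : BinaryLinearCode N) {ε : ℝ} (h0 : 0 ≤ ε) (h1 : ε ≤ 1)
    (x : Fin N → ZMod 2) (y : Fin N → Option (ZMod 2)) : 0 ≤ jointProb C ε x y := by
  unfold jointProb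
  split_ifs
  · exact mul_nonneg (by positivity) (prod_nonneg fun i _ => becTransition_nonneg h0 h1 _ _)
  · exact le_rfl

theorem mem_of_jointProb_ne_zero {C : BinaryLinearCode N} {ε : ℝ} {x : Fin N → ZMod 2}
    {y : Fin N → Option (ZMod 2)} (h : jointProb C ε x y ≠ 0) : x ∈ C := by
  by_contra hx
  exact h (by simp [jointProb, hx])

theorem eq_of_jointProb_ne_zero {C : BinaryLinearCode N} {ε : ℝ} {x : Fin N → ZMod 2}
    {y : Fin N → Option (ZMod 2)} (h : jointProb C ε x y ≠ 0) {j : Fin N} {z : ZMod 2}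
    (hz : y j = some z) : z = x j := by
  by_contra hne
  refine h ?_
  unfold jointProb
  split_ifs
  · rw [prod_eq_zero (mem_univ j) (by simp [hz, becTransition, hne]), mul_zero]
  · rfl

/-- The bit-MAP decoder is correct if the bit is determined by the other received bits. -/
theorem bitMAP_eq_of_exitIndicator_eq_zero {C : BinaryLinearCode N} {ε : ℝ} (h0 : 0 ≤ ε)
    (h1 : ε ≤ 1) {i : Fin N} {x : Fin N → ZMod 2} {y : Fin N → Option (ZMod 2)}
    (h : jointProb C ε x y ≠ 0) (hi : C.exitIndicator i (fun j => (y j).isSome) = 0) :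
    bitMAP C ε i y = some (x i) := by
  have hdet : ∀ x', jointProb C ε x' y ≠ 0 → x' i = x i := by
    intro x' h'
    by_contra hne
    refine one_ne_zero (α := ℝ) (Eq.trans (Eq.symm ?_) hi)
    -- Two codewords compatible with `y` differ by a codeword that vanishes on all received
    -- positions.
    refine if_pos ⟨x' - x, C.sub_mem (mem_of_jointProb_ne_zero h') (mem_of_jointProb_ne_zero h),
      fun j _ hj => ?_, sub_ne_zero.2 hne⟩
    obtain ⟨z, hz⟩ := Option.isSome_iff_exists.1 hj
    exact sub_eq_zero.2 ((eq_of_jointProb_ne_zero h' hz).symm.trans (eq_of_jointProb_ne_zero h hz))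
  have hpos : 0 < jointProb C ε x y := lt_of_le_of_ne (C.jointProb_nonneg h0 h1 x y) h.symm
  have hout : 0 < outputProb C ε y :=
    hpos.trans_le (single_le_sum (fun x' _ => C.jointProb_nonneg h0 h1 x' y) (mem_univ x))
  have hgood : 0 < bitPosterior C ε i (x i) y := by
    refine div_pos (lt_of_lt_of_le hpos ?_) hout
    refine le_trans (le_of_eq ?_) (single_le_sum (fun x' _ => ?_) (mem_univ x))
    · simp
    · split_ifs
      · exact C.jointProb_nonneg h0 h1 x' y
      · exact le_rfl
  have hbad : ∀ b, b ≠ x i → bitPosterior C ε i b y = 0 := by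
    intro b hb
    refine div_eq_zero_iff.2 (Or.inl (sum_eq_zero fun x' _ => ?_))
    split_ifs with hx'
    · by_contra hne
      exact hb (hx'.symm.trans (hdet x' hne))
    · rfl
  have h01 : ∀ b : ZMod 2, b = 0 ∨ b = 1 := by decide
  unfold bitMAP
  rcases h01 (x i) with hx | hx
  · rw [hx] at hgood hbad ⊢
    rw [hbad 1 (by decide), if_pos hgood]
  · rw [hx] at hgood hbad ⊢
    rw [hbad 0 (by decide), if_neg (not_lt.2 hgood.le), if_pos hgood]

/-- Given `x`, an output without a wrong bit is determined by its set of received positions; all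
other outputs have probability zero. -/
theorem sum_prod_becTransition_mul (ε : ℝ) (x : Fin N → ZMod 2) (F : (Fin N → Bool) → ℝ) :
    ∑ y : Fin N → Option (ZMod 2), (∏ j, becTransition ε (x j) (y j)) * F (fun j => (y j).isSome) =
      mean (1 - ε) F := by
  symm
  refine Fintype.sum_of_injective
    (fun (s : Fin N → Bool) j => if s j = true then some (x j) else none) ?_ _ _ ?_ ?_
  · intro s t hst
    ext j
    have := congrFun hst j
    cases hs : s j <;> cases ht : t j <;> simp_all
  · intro y hy
    have : ∃ j, y j ≠ none ∧ y j ≠ some (x j) := by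
      by_contra! hall
      refine hy ⟨fun j => (y j).isSome, ?_⟩
      ext1 j
      by_cases hj : y j = none
      · simp [hj]
      · simp [hall j hj]
    obtain ⟨j, hj, hj'⟩ := this
    obtain ⟨z, hz⟩ := Option.ne_none_iff_exists'.1 hj
    rw [prod_eq_zero (mem_univ j), zero_mul]
    rw [hz] at hj' ⊢
    exact if_neg fun h => hj' (by rw [h])
  · intro s
    have e1 : (fun j => (if s j = true then some (x j) else none : Option (ZMod 2)).isSome) = s := by
      ext j; cases hs : s j <;> simp
    rw [e1, weight]
    congr 1
    refine prod_congr rfl fun j _ => ?_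
    cases hs : s j <;> simp [becTransition, hs]

theorem bitErrorProb_le_exit (C : BinaryLinearCode N) {ε : ℝ} (h0 : 0 ≤ ε) (h1 : ε ≤ 1)
    (i : Fin N) : bitErrorProb C ε i ≤ C.exit i (1 - ε) := by
  classical
  have hle : bitErrorProb C ε i ≤ ∑ x : Fin N → ZMod 2, ∑ y : Fin N → Option (ZMod 2),
      jointProb C ε x y * C.exitIndicator i fun j => (y j).isSome := by
    refine sum_le_sum fun x _ => sum_le_sum fun y _ => ?_
    have hnn := C.jointProb_nonneg h0 h1 x y
    split_ifs with hdec
    · exact mul_nonneg hnn (C.exitIndicator_nonneg i _)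
    · by_cases hj : jointProb C ε x y = 0
      · simp [hj]
      · have hne : C.exitIndicator i (fun j => (y j).isSome) ≠ 0 := fun h =>
          hdec (bitMAP_eq_of_exitIndicator_eq_zero h0 h1 hj h)
        have hone : C.exitIndicator i (fun j => (y j).isSome) = 1 := by
          have := C.exitIndicator_sq i fun j => (y j).isSome
          rw [sq] at this
          exact mul_right_cancel₀ hne (by rw [this, one_mul])
        rw [hone, mul_one]
  refine hle.trans (le_of_eq ?_)
  have hx : ∀ x : Fin N → ZMod 2, ∑ y : Fin N → Option (ZMod 2),
      jointProb C ε x y * C.exitIndicator i (fun j => (y j).isSome) =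
      if x ∈ C then (1 / (Nat.card C : ℝ)) * C.exit i (1 - ε) else 0 := by
    intro x
    unfold jointProb
    split_ifs
    · rw [exit, ← sum_prod_becTransition_mul ε x, mul_sum]
      exact sum_congr rfl fun y _ => by ring
    · simp
  have hcard : (#{x : Fin N → ZMod 2 | x ∈ C} : ℝ) = Nat.card C := by
    rw [Nat.card_eq_fintype_card, Fintype.card_subtype]
  have hpos : (Nat.card C : ℝ) ≠ 0 := Nat.cast_ne_zero.2 Nat.card_pos.ne'
  rw [sum_congr rfl fun x _ => hx x, ← sum_filter, sum_const, nsmul_eq_mul, hcard]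
  field_simp

/-- Sequences of 2-transitive codes achieve capacity on the erasure channel under bit-MAP
decoding. -/
theorem bitErrorVanishesBelowCapacity_of_isTwoTransitive {N : ℕ → ℕ}
    {C : ∀ k, BinaryLinearCode (N k)} {R : ℝ} (hN : Tendsto N atTop atTop)
    (hC : ∀ k, (C k).IsTwoTransitive) (hR : 0 < R)
    (hrate : Tendsto (fun k => (C k).rate) atTop (𝓝 R)) : BitErrorVanishesBelowCapacity C R := by
  intro ε hε0 hε δ hδ
  obtain ⟨p₀, hp₀⟩ : ∃ p₀, p₀ = 1 - ε := ⟨_, rfl⟩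
  -- Since `R < p₁ < p₀`, there is room for the jump between `p₁` and `p₀`. The choice of `η` makes
  -- `(1 - η) * p₁` the midpoint of `R` and `p₁`, still above `R`; the slope `D` would give a drop
  -- of 2.
  obtain ⟨p₁, hp₁⟩ : ∃ p₁, p₁ = (R + p₀) / 2 := ⟨_, rfl⟩
  have hp₁0 : 0 < p₁ := by linarith
  obtain ⟨η, hη⟩ : ∃ η, η = (1 - R / p₁) / 2 := ⟨_, rfl⟩
  have hη0 : 0 < η := by
    have : R / p₁ < 1 := (div_lt_one hp₁0).2 (by linarith)
    linarith
  have hηp : (1 - η) * p₁ = (p₁ + R) / 2 := by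
    rw [hη]; field_simp; ring
  obtain ⟨D, hD⟩ : ∃ D, D = 2 / (p₀ - p₁) := ⟨_, rfl⟩
  have hpp : 0 < p₀ - p₁ := by linarith
  have hD1 : D * (p₀ - p₁) = 2 := by rw [hD]; field_simp
  have hlog : Tendsto (fun k => δ * η * Real.log ((N k : ℝ) - 1)) atTop atTop := by
    refine Tendsto.const_mul_atTop (mul_pos hδ hη0) (Real.tendsto_log_atTop.comp ?_)
    exact tendsto_atTop_add_const_right _ (-1) (tendsto_natCast_atTop_atTop.comp hN)
  have hev := ((hrate.eventually_lt_const (show R < (p₁ + R) / 2 by linarith)).and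
    (hN.eventually_ge_atTop 2)).and (hlog.eventually_ge_atTop (2 * D + D ^ 2))
  obtain ⟨k₀, hk₀⟩ := eventually_atTop.1 hev
  refine ⟨k₀, fun k hk i => ?_⟩
  obtain ⟨⟨h1, h2⟩, h3⟩ := hk₀ k hk.le
  by_contra! hlt
  have hexit : δ ≤ (C k).exit i p₀ := by
    rw [hp₀]
    exact hlt.le.trans ((C k).bitErrorProb_le_exit hε0 (by linarith) i)
  have h4 := (hC k).le_exit_of_lt_exit h2 i hp₁0.le (by linarith) (by linarith) hδ hη0.le
    (hD ▸ (div_pos two_pos hpp).le) (by linarith) h3 hexit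
  have h5 := (hC k).mul_le_rate h2 i hp₁0.le (by linarith) h4
  linarith

end BinaryLinearCode

theorem tendsto_two_pow_sub_one_add_one {m : ℕ → ℕ} (hm : Tendsto m atTop atTop) :
    Tendsto (fun k => 2 ^ m k - 1 + 1) atTop atTop := by
  refine tendsto_atTop_mono (fun k => ?_) hm
  have := (Nat.lt_two_pow_self (n := m k)).le
  omega

end

theorem mainTheorem2 :
    (∀ (N : ℕ → ℕ) (C : ∀ k, BinaryLinearCode (N k)) (R : ℝ),
      Tendsto N atTop atTop →
      (∀ k, (C k).IsTwoTransitive) →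
      0 < R → R < 1 →
      Tendsto (fun k => (C k).rate) atTop (𝓝 R) →
      BinaryLinearCode.BitErrorVanishesBelowCapacity C R) ∧
    (∀ (m : ℕ), 1 ≤ m → ∀ α : GaloisField 2 m, IsPrimitiveRoot α (2 ^ m - 1) → ∀ d : ℕ,
      (BinaryLinearCode.extendedBCH m α d).IsTwoTransitive) ∧
    (∀ (m : ℕ → ℕ) (α : ∀ k, GaloisField 2 (m k)) (d : ℕ → ℕ) (R : ℝ),
      Tendsto m atTop atTop →
      (∀ k, 1 ≤ m k) →
      (∀ k, IsPrimitiveRoot (α k) (2 ^ m k - 1)) →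
      0 < R → R < 1 →
      Tendsto (fun k => (BinaryLinearCode.extendedBCH (m k) (α k) (d k)).rate) atTop (𝓝 R) →
      BinaryLinearCode.BitErrorVanishesBelowCapacity
        (fun k => BinaryLinearCode.extendedBCH (m k) (α k) (d k)) R) := by
  refine ⟨fun N C R hN hC hR _ hrate =>
      BinaryLinearCode.bitErrorVanishesBelowCapacity_of_isTwoTransitive hN hC hR hrate,
    fun m hm α hα d => BinaryLinearCode.isTwoTransitive_extendedBCH hm hα d,
    fun m α d R hm hm1 hα hR _ hrate =>
      BinaryLinearCode.bitErrorVanishesBelowCapacity_of_isTwoTransitive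
        (tendsto_two_pow_sub_one_add_one hm)
        (fun k => BinaryLinearCode.isTwoTransitive_extendedBCH (hm1 k) (hα k) (d k)) hR hrate⟩
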